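/- Let $\mathbb W=\{X+Yj: X,Y\in\mathbb R\}$, $j^2=1$, be the double (split-complex) numbers, and for $p=(p_1,p_2)$, $q=(q_1,q_2)$ in $\mathbb W^2$ let $$\rho(p,q)=(p_1-q_1)^2+(p_2-q_2)^2\in\mathbb W .$$ For a finite set $P\subset\mathbb W^2$ let $D(P)=|\{\rho(p,q): p,q\in P\}|$ be the number of distinct distances that it determines. For a point $p=(X+Yj,\,Z+Wj)$ call $(X+Y,\,Z+W)\in\mathbb R^2$ its real part and $(X-Y,\,Z-W)\in\mathbb R^2$ its imaginary part. There is an absolute constant $C>0$ such that the following two statements hold. (i) For every integer $m\ge 2$, the set $P_m$ of all points of $\mathbb W^2$ whose real part and imaginary part both lie in the integer grid $\{1,\dots,m\}\times\{1,\dots,m\}$ has exactly $n=m^4$ points and satisfies $D(P_m)\le C\,n/\log n$. (ii) For every integer $n\ge 2$ there is a set $P\subset\mathbb W^2$ of exactly $n$ points with $D(P)\le C\,n/\log n$. -/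

import Mathlib

/-- The double (split-complex, hyperbolic) numbers `X + Y j` with `X, Y` real and `j ^ 2 = 1`:
`re` is `X` and `im` is `Y`. -/
abbrev DoubleNumber : Type := QuadraticAlgebra ℝ 1 0

/-- The double plane: all pairs `(X + Y j, Z + W j)` of double numbers. -/
abbrev DoublePlane : Type := DoubleNumber × DoubleNumber

namespace DoublePlane

/-- The Euclidean-style distance on the double plane, with values in the double numbers. -/
noncomputable def rho (p q : DoublePlane) : DoubleNumber :=
  (p.1 - q.1) ^ 2 + (p.2 - q.2) ^ 2

/-- The set of distances spanned by a set of points (including the distance `0` from a point to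
itself). -/
def distanceSet (P : Set DoublePlane) : Set DoubleNumber :=
  {d | ∃ p ∈ P, ∃ q ∈ P, rho p q = d}

/-- The number of distinct distances spanned by `P` (meaningful for finite `P`). -/
noncomputable def numDistances (P : Set DoublePlane) : ℕ :=
  (distanceSet P).ncard

/-- The real part `(x, z) = (X + Y, Z + W)` of the point `(X + Y j, Z + W j)`. -/
noncomputable def realPart (p : DoublePlane) : ℝ × ℝ :=
  (p.1.re + p.1.im, p.2.re + p.2.im)

/-- The imaginary part `(y, w) = (X - Y, Z - W)` of the point `(X + Y j, Z + W j)`. -/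
noncomputable def imagPart (p : DoublePlane) : ℝ × ℝ :=
  (p.1.re - p.1.im, p.2.re - p.2.im)

/-- The `m × m` section `{1, …, m} × {1, …, m}` of the integer lattice in the real plane. -/
def intGrid (m : ℕ) : Set (ℝ × ℝ) :=
  {v | ∃ a ∈ Finset.Icc 1 m, ∃ b ∈ Finset.Icc 1 m, v = ((a : ℝ), (b : ℝ))}

/-- The product of two copies of the `m × m` integer grid, one placed in the real part and one in
the imaginary part. -/
def gridProduct (m : ℕ) : Set DoublePlane :=
  {p | realPart p ∈ intGrid m ∧ imagPart p ∈ intGrid m}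

end DoublePlane

/-! Since j² = 1, X + Yj ↦ (X + Y, X − Y) is a ring isomorphism 𝕎 ≅ ℝ × ℝ, so `rho` becomes a pair
of squared Euclidean distances, one between real parts and one between imaginary parts. On
`gridProduct m` both are sums of two squares up to 2m², and Landau's O(N/√log N) for their number,
squared, gives O(m⁴/log m). A general n is handled by a subset of a slightly larger grid.

Landau's upper bound is proved elementarily. Let f be the indicator of `DivisorsOneModFour`. A
positive sum of two squares is c²k or 2c²k with f(k) = 1. From log = Λ * 1 on divisors and
Chebyshev, ∑ f(k) log k ≪ y ∑ f(k)/k (`sum_oneModFourIndicator_mul_log_le`). Comparing f * f with χ₄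
* 1 gives (∑ f(k)/k)² ≪ log N (`sum_oneModFourInv_sq_le`). Summing over c combines the two. -/

/-! ### Integers with all divisors 1 mod 4, and weights on them -/

/-- All divisors of `n` are congruent to `1` modulo `4`; equivalently, `n` is a product of primes
congruent to `1` modulo `4`. -/
def DivisorsOneModFour (n : ℕ) : Prop :=
  ∀ d, d ∣ n → d % 4 = 1

namespace DivisorsOneModFour

theorem of_dvd {m n : ℕ} (hn : DivisorsOneModFour n) (h : m ∣ n) : DivisorsOneModFour m :=
  fun d hd => hn d (hd.trans h)

theorem mul {m n : ℕ} (hm : DivisorsOneModFour m) (hn : DivisorsOneModFour n) :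
    DivisorsOneModFour (m * n) := by
  intro d hd
  obtain ⟨a, b, ha, hb, rfl⟩ := (Nat.dvd_mul).1 hd
  rw [Nat.mul_mod, hm a ha, hn b hb]

theorem ne_zero {n : ℕ} (hn : DivisorsOneModFour n) : n ≠ 0 := by
  rintro rfl
  simpa using hn 2 (dvd_zero 2)

end DivisorsOneModFour

open Classical in
/-- The indicator function of `DivisorsOneModFour`. -/
noncomputable def oneModFourIndicator : ArithmeticFunction ℝ :=
  ⟨fun n => if DivisorsOneModFour n then 1 else 0, if_neg fun h => h.ne_zero rfl⟩

/-- The function `n ↦ 1 / n` on the `n` with `DivisorsOneModFour n`, zero elsewhere. -/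
noncomputable def oneModFourInv : ArithmeticFunction ℝ :=
  ⟨fun n => oneModFourIndicator n / n, by simp⟩

/-- The function `n ↦ χ₄ n / n`. -/
noncomputable def chiFourInv : ArithmeticFunction ℝ :=
  ⟨fun n => (ZMod.χ₄ n : ℝ) / n, by simp⟩

/-- The function `n ↦ 1 / n`. -/
noncomputable def natInv : ArithmeticFunction ℝ :=
  ⟨fun n => 1 / n, by simp⟩

theorem oneModFourIndicator_apply_of {n : ℕ} (h : DivisorsOneModFour n) :
    oneModFourIndicator n = 1 := if_pos h

theorem oneModFourIndicator_apply_of_not {n : ℕ} (h : ¬ DivisorsOneModFour n) :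
    oneModFourIndicator n = 0 := if_neg h

theorem oneModFourIndicator_nonneg (n : ℕ) : 0 ≤ oneModFourIndicator n := by
  by_cases h : DivisorsOneModFour n
  · simp [oneModFourIndicator_apply_of h]
  · simp [oneModFourIndicator_apply_of_not h]

theorem oneModFourInv_apply (n : ℕ) : oneModFourInv n = oneModFourIndicator n / n := rfl

theorem chiFourInv_apply (n : ℕ) : chiFourInv n = (ZMod.χ₄ n : ℝ) / n := rfl

theorem natInv_apply (n : ℕ) : natInv n = 1 / n := rfl

theorem oneModFourInv_nonneg (n : ℕ) : 0 ≤ oneModFourInv n :=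
  div_nonneg (oneModFourIndicator_nonneg n) n.cast_nonneg

/-! ### Reciprocal sums, by comparison with χ₄ -/

theorem sum_divisors_chiFour_nonneg (n : ℕ) : 0 ≤ ∑ d ∈ n.divisors, ZMod.χ₄ d := by
  have hq : (ZMod.χ₄.ringHomComp (Int.castRingHom ℂ)) ^ 2 = 1 :=
    MulChar.isQuadratic_iff_sq_eq_one.1 (ZMod.isQuadratic_χ₄.comp _)
  have h := DirichletCharacter.zetaMul_nonneg (N := 4) hq n
  rw [DirichletCharacter.zetaMul, ArithmeticFunction.coe_zeta_mul_apply] at h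
  have e : ∑ d ∈ n.divisors, (toArithmeticFunction
      (fun m : ℕ => (ZMod.χ₄.ringHomComp (Int.castRingHom ℂ)) m)) d
      = ((∑ d ∈ n.divisors, ZMod.χ₄ d : ℤ) : ℂ) := by
    push_cast
    refine Finset.sum_congr rfl fun d hd => ?_
    have : d ≠ 0 := (Nat.pos_of_mem_divisors hd).ne'
    simp [toArithmeticFunction, this]
  rw [e, ← Complex.ofReal_intCast, Complex.zero_le_real] at h
  exact_mod_cast h

theorem chiFourInv_mul_natInv_apply (n : ℕ) :
    (chiFourInv * natInv) n = ((∑ d ∈ n.divisors, ZMod.χ₄ d : ℤ) : ℝ) / n := by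
  rw [ArithmeticFunction.mul_apply, Int.cast_sum, Finset.sum_div,
    Nat.sum_divisorsAntidiagonal fun a b => chiFourInv a * natInv b]
  refine Finset.sum_congr rfl fun d hd => ?_
  have h0 : d ≠ 0 := (Nat.pos_of_mem_divisors hd).ne'
  have hn : n ≠ 0 := (Nat.mem_divisors.1 hd).2
  rw [chiFourInv_apply, natInv_apply, Nat.cast_div (Nat.dvd_of_mem_divisors hd) (by exact_mod_cast h0)]
  field_simp

/-- If all divisors of n are 1 mod 4, the indicator and χ₄ are both 1 on them and equality holds.
Otherwise every factorization of n has a bad factor, so the left side vanishes. -/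
theorem oneModFourInv_mul_self_le (n : ℕ) :
    (oneModFourInv * oneModFourInv) n ≤ (chiFourInv * natInv) n := by
  by_cases h : DivisorsOneModFour n
  · rw [ArithmeticFunction.mul_apply, ArithmeticFunction.mul_apply]
    refine le_of_eq (Finset.sum_congr rfl fun x hx => ?_)
    have hx' := (Nat.mem_divisorsAntidiagonal.1 hx).1
    have h1 : x.1 ∣ n := ⟨x.2, hx'.symm⟩
    have h2 : x.2 ∣ n := ⟨x.1, by rw [mul_comm, hx']⟩
    rw [oneModFourInv_apply, oneModFourInv_apply, oneModFourIndicator_apply_of (h.of_dvd h1),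
      oneModFourIndicator_apply_of (h.of_dvd h2), chiFourInv_apply, natInv_apply,
      ZMod.χ₄_nat_one_mod_four (h _ h1), Int.cast_one]
  · have : (oneModFourInv * oneModFourInv) n = 0 := by
      rw [ArithmeticFunction.mul_apply]
      refine Finset.sum_eq_zero fun x hx => ?_
      have hx' := (Nat.mem_divisorsAntidiagonal.1 hx).1
      by_cases h1 : DivisorsOneModFour x.1
      · have h2 : ¬ DivisorsOneModFour x.2 := fun h2 => h (hx' ▸ h1.mul h2)
        simp [oneModFourInv_apply, oneModFourIndicator_apply_of_not h2]
      · simp [oneModFourInv_apply, oneModFourIndicator_apply_of_not h1]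
    rw [this, chiFourInv_mul_natInv_apply]
    exact div_nonneg (by exact_mod_cast sum_divisors_chiFour_nonneg n) n.cast_nonneg

/-- An alternating sum of a decreasing nonnegative function is at most its first term. -/
theorem sum_chiFour_mul_le {g : ℕ → ℝ} (hg : ∀ a b, 1 ≤ a → a ≤ b → g b ≤ g a)
    (q : ℕ) : ∑ d ∈ Finset.range (4 * q + 1), (ZMod.χ₄ d : ℝ) * g d ≤ g 1 - g (4 * q + 1) := by
  -- The subtracted `g (4 * q + 1)` makes the induction close: it cancels the next positive term,
  -- and the following negative term replaces it.
  induction q with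
  | zero => simp
  | succ q ih =>
    have e : 4 * (q + 1) + 1 = 4 * q + 1 + 1 + 1 + 1 + 1 := by ring
    rw [e, Finset.sum_range_succ, Finset.sum_range_succ, Finset.sum_range_succ,
      Finset.sum_range_succ]
    have h0 : ZMod.χ₄ ((4 * q + 1 : ℕ) : ZMod 4) = 1 := ZMod.χ₄_nat_one_mod_four (by omega)
    have h2 : ZMod.χ₄ ((4 * q + 1 + 1 + 1 : ℕ) : ZMod 4) = -1 :=
      ZMod.χ₄_nat_three_mod_four (by omega)
    have h1 : ZMod.χ₄ ((4 * q + 1 + 1 : ℕ) : ZMod 4) = 0 := by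
      rw [ZMod.χ₄_nat_eq_if_mod_four, if_pos (by omega)]
    have h3 : ZMod.χ₄ ((4 * q + 1 + 1 + 1 + 1 : ℕ) : ZMod 4) = 0 := by
      rw [ZMod.χ₄_nat_eq_if_mod_four, if_pos (by omega)]
    rw [h0, h1, h2, h3]
    have := hg (4 * q + 1 + 1 + 1) (4 * q + 1 + 1 + 1 + 1 + 1) (by omega) (by omega)
    push_cast
    linarith

theorem sum_natInv_le (N : ℕ) : ∑ n ∈ Finset.Ioc 0 N, natInv n ≤ 1 + Real.log N := by
  have h := harmonic_le_one_add_log N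
  rw [harmonic_eq_sum_Icc] at h
  push_cast at h
  simpa [natInv_apply, ← Finset.Icc_add_one_left_eq_Ioc] using h

theorem natInv_nonneg (n : ℕ) : 0 ≤ natInv n := by
  rw [natInv_apply]; positivity

/-- Grouping by the χ₄ variable d leaves weights g(d) = (1/d) ∑_{m ≤ N/d} 1/m, decreasing in d, so
the alternating sum is at most g(1). -/
theorem sum_chiFourInv_mul_natInv_le (N : ℕ) :
    ∑ n ∈ Finset.Ioc 0 N, (chiFourInv * natInv) n ≤ 1 + Real.log N := by
  rw [ArithmeticFunction.sum_Ioc_mul_eq_sum_sum]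
  set g : ℕ → ℝ := fun d => (1 / d) * ∑ m ∈ Finset.Ioc 0 (N / d), natInv m with hgdef
  have hg0 : ∀ d, 0 ≤ g d := fun d =>
    mul_nonneg (by positivity) (Finset.sum_nonneg fun _ _ => natInv_nonneg _)
  have hg : ∀ a b, 1 ≤ a → a ≤ b → g b ≤ g a := by
    intro a b ha hab
    have ha' : (0 : ℝ) < a := by exact_mod_cast ha
    have hab' : (a : ℝ) ≤ b := by exact_mod_cast hab
    refine mul_le_mul (one_div_le_one_div_of_le ha' hab') ?_
      (Finset.sum_nonneg fun _ _ => natInv_nonneg _) (by positivity)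
    exact Finset.sum_le_sum_of_subset_of_nonneg
      (Finset.Ioc_subset_Ioc_right (Nat.div_le_div_left hab ha)) fun _ _ _ => natInv_nonneg _
  have e : ∑ n ∈ Finset.Ioc 0 N, chiFourInv n * ∑ m ∈ Finset.Ioc 0 (N / n), natInv m
      = ∑ d ∈ Finset.range (4 * N + 1), (ZMod.χ₄ d : ℝ) * g d := by
    have : ∀ n, chiFourInv n * ∑ m ∈ Finset.Ioc 0 (N / n), natInv m = (ZMod.χ₄ n : ℝ) * g n := by
      intro n
      rw [chiFourInv_apply, hgdef]; ring
    simp_rw [this]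
    -- The range is padded to whole periods of χ₄; terms beyond N vanish because `N / x = 0`.
    refine Finset.sum_subset (fun x hx => ?_) fun x _ hx => ?_
    · simp only [Finset.mem_Ioc, Finset.mem_range] at *; omega
    · rcases Nat.eq_zero_or_pos x with rfl | h
      · simp
      · have : N / x = 0 := Nat.div_eq_of_lt (by simp only [Finset.mem_Ioc] at hx; omega)
        simp [hgdef, this]
  rw [e]
  refine (sum_chiFour_mul_le hg N).trans ?_
  have h1 : g 1 ≤ 1 + Real.log N := by simpa [hgdef] using sum_natInv_le N
  linarith [hg0 (4 * N + 1)]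

/-- Pairs a, b ≤ N have ab ≤ N², so the square is at most the convolution summed up to N². -/
theorem sum_oneModFourInv_sq_le (N : ℕ) :
    (∑ n ∈ Finset.Ioc 0 N, oneModFourInv n) ^ 2 ≤ 1 + 2 * Real.log N := by
  have h1 : (∑ n ∈ Finset.Ioc 0 N, oneModFourInv n) ^ 2
      ≤ ∑ n ∈ Finset.Ioc 0 (N * N), (oneModFourInv * oneModFourInv) n := by
    rw [ArithmeticFunction.sum_Ioc_mul_eq_sum_prod_filter, sq, Finset.sum_mul_sum,
      ← Finset.sum_product']
    refine Finset.sum_le_sum_of_subset_of_nonneg (fun x hx => ?_)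
      fun x _ _ => mul_nonneg (oneModFourInv_nonneg _) (oneModFourInv_nonneg _)
    simp only [Finset.mem_product, Finset.mem_Ioc, Finset.mem_filter] at *
    obtain ⟨⟨a0, a1⟩, b0, b1⟩ := hx
    have := Nat.mul_le_mul a1 b1
    refine ⟨⟨⟨a0, ?_⟩, b0, ?_⟩, this⟩ <;> nlinarith
  refine h1.trans ((Finset.sum_le_sum fun n _ => oneModFourInv_mul_self_le n).trans
    ((sum_chiFourInv_mul_natInv_le _).trans ?_))
  rcases Nat.eq_zero_or_pos N with rfl | h
  · simp
  · have : (N : ℝ) ≠ 0 := by positivity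
    rw [Nat.cast_mul, Real.log_mul this this]
    linarith

/-! ### Chebyshev's bound and logarithmic weights -/

/-- Since `log k` is the sum of the von Mangoldt function over the divisors of `k`, Chebyshev's
bound controls the sum of `log k`. -/
theorem sum_oneModFourIndicator_mul_log_le (y : ℕ) :
    ∑ k ∈ Finset.Ioc 0 y, oneModFourIndicator k * Real.log k
      ≤ (Real.log 4 + 4) * y * ∑ k ∈ Finset.Ioc 0 y, oneModFourInv k := by
  calc ∑ k ∈ Finset.Ioc 0 y, oneModFourIndicator k * Real.log k
      ≤ ∑ k ∈ Finset.Ioc 0 y, (oneModFourIndicator * ArithmeticFunction.vonMangoldt) k := by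
        refine Finset.sum_le_sum fun k _ => ?_
        have h0 : ∀ x : ℕ × ℕ, 0 ≤ oneModFourIndicator x.1 * ArithmeticFunction.vonMangoldt x.2 :=
          fun x => mul_nonneg (oneModFourIndicator_nonneg _)
            ArithmeticFunction.vonMangoldt_nonneg
        rw [ArithmeticFunction.mul_apply]
        by_cases h : DivisorsOneModFour k
        · rw [oneModFourIndicator_apply_of h, one_mul, ← ArithmeticFunction.vonMangoldt_sum,
            Nat.sum_divisorsAntidiagonal' fun a b =>
              oneModFourIndicator a * ArithmeticFunction.vonMangoldt b]
          refine le_of_eq (Finset.sum_congr rfl fun d hd => ?_)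
          have hd' : k / d ∣ k := Nat.div_dvd_of_dvd (Nat.dvd_of_mem_divisors hd)
          rw [oneModFourIndicator_apply_of (h.of_dvd hd'), one_mul]
        · rw [oneModFourIndicator_apply_of_not h, zero_mul]
          exact Finset.sum_nonneg fun x _ => h0 x
    _ = ∑ k ∈ Finset.Ioc 0 y, oneModFourIndicator k *
          ∑ m ∈ Finset.Ioc 0 (y / k), ArithmeticFunction.vonMangoldt m :=
        ArithmeticFunction.sum_Ioc_mul_eq_sum_sum _ _ _
    _ ≤ ∑ k ∈ Finset.Ioc 0 y, (Real.log 4 + 4) * y * oneModFourInv k := by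
        refine Finset.sum_le_sum fun k _ => ?_
        have hpsi : ∑ m ∈ Finset.Ioc 0 (y / k), ArithmeticFunction.vonMangoldt m
            = Chebyshev.psi ((y / k : ℕ) : ℝ) := by
          rw [Chebyshev.psi, Nat.floor_natCast]
        rw [hpsi, oneModFourInv_apply]
        have h1 := Chebyshev.psi_le_const_mul_self (x := ((y / k : ℕ) : ℝ)) (Nat.cast_nonneg _)
        have h2 : ((y / k : ℕ) : ℝ) ≤ (y : ℝ) / k := Nat.cast_div_le
        have h3 : (0 : ℝ) ≤ Real.log 4 + 4 := by positivity
        calc oneModFourIndicator k * Chebyshev.psi ((y / k : ℕ) : ℝ)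
            ≤ oneModFourIndicator k * ((Real.log 4 + 4) * ((y : ℝ) / k)) :=
              mul_le_mul_of_nonneg_left (h1.trans (mul_le_mul_of_nonneg_left h2 h3))
                (oneModFourIndicator_nonneg _)
          _ = _ := by ring
    _ = _ := by rw [Finset.mul_sum]

/-! ### Structure of sums of two squares -/

/-- Each divisor d inherits a square root of −1, hence is an odd sum of two squares. -/
theorem divisorsOneModFour_of_isSquare_neg_one {n : ℕ} (hodd : n % 2 = 1)
    (h : IsSquare (-1 : ZMod n)) : DivisorsOneModFour n := by
  intro d hd
  obtain ⟨x, y, hxy⟩ := Nat.eq_sq_add_sq_of_isSquare_mod_neg_one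
    (ZMod.isSquare_neg_one_of_dvd hd h)
  have hd2 : d % 2 = 1 := by
    obtain ⟨e, rfl⟩ := hd
    exact (Nat.odd_mul.1 (Nat.odd_iff.2 hodd)).1 |> Nat.odd_iff.1
  have hx : x ^ 2 % 4 = 0 ∨ x ^ 2 % 4 = 1 := by
    have : x % 4 < 4 := Nat.mod_lt _ (by norm_num)
    rw [Nat.pow_mod]
    interval_cases x % 4 <;> simp
  have hy : y ^ 2 % 4 = 0 ∨ y ^ 2 % 4 = 1 := by
    have : y % 4 < 4 := Nat.mod_lt _ (by norm_num)
    rw [Nat.pow_mod]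
    interval_cases y % 4 <;> simp
  omega

/-- A positive sum of two squares is `c ^ 2 * k` or `2 * (c ^ 2 * k)`, where all divisors of `k`
are congruent to `1` modulo `4`. -/
theorem exists_eq_mul_sq_mul_of_eq_sq_add_sq {n : ℕ} (hn : n ≠ 0)
    (h : ∃ x y : ℕ, n = x ^ 2 + y ^ 2) :
    ∃ c k : ℕ, DivisorsOneModFour k ∧ (n = c ^ 2 * k ∨ n = 2 * (c ^ 2 * k)) := by
  obtain ⟨c, b, rfl, hb⟩ := Nat.eq_sq_add_sq_iff_eq_sq_mul.1 h
  rcases Nat.mod_two_eq_zero_or_one b with h2 | h2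
  · obtain ⟨k, rfl⟩ := Nat.dvd_of_mod_eq_zero h2
    refine ⟨c, k, divisorsOneModFour_of_isSquare_neg_one ?_
      (ZMod.isSquare_neg_one_of_dvd (Dvd.intro_left 2 rfl) hb), Or.inr (by ring)⟩
    -- If k were even, 4 would divide 2k and −1 would be a square mod 4.
    by_contra hk
    obtain ⟨l, rfl⟩ := Nat.dvd_of_mod_eq_zero (Nat.mod_two_ne_one.1 hk)
    have h4 : IsSquare (-1 : ZMod 4) :=
      ZMod.isSquare_neg_one_of_dvd ⟨l, by ring⟩ hb
    revert h4
    decide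
  · exact ⟨c, b, divisorsOneModFour_of_isSquare_neg_one h2 hb, Or.inl rfl⟩

/-! ### Landau's upper bound -/

/-- The number of pairs `(c, k)` of positive integers with `c ^ 2 * k ≤ N` and
`DivisorsOneModFour k`. -/
noncomputable def sqMulCount (N : ℕ) : ℝ :=
  ∑ c ∈ Finset.Ioc 0 N, ∑ k ∈ Finset.Ioc 0 (N / c ^ 2), oneModFourIndicator k

theorem sum_oneModFourInv_nonneg (N : ℕ) : 0 ≤ ∑ k ∈ Finset.Ioc 0 N, oneModFourInv k :=
  Finset.sum_nonneg fun _ _ => oneModFourInv_nonneg _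

theorem sum_oneModFourInv_mono {M N : ℕ} (h : M ≤ N) :
    ∑ k ∈ Finset.Ioc 0 M, oneModFourInv k ≤ ∑ k ∈ Finset.Ioc 0 N, oneModFourInv k :=
  Finset.sum_le_sum_of_subset_of_nonneg (Finset.Ioc_subset_Ioc_right h)
    fun _ _ _ => oneModFourInv_nonneg _

theorem exists_sum_one_add_two_mul_log_div_sq_le :
    ∃ A : ℝ, 0 < A ∧
      ∀ N : ℕ, ∑ c ∈ Finset.Ioc 0 N, (1 + 2 * Real.log c) / (c : ℝ) ^ 2 ≤ A := by
  have hs : Summable fun c : ℕ => 5 * (1 / (c : ℝ) ^ (3 / 2 : ℝ)) :=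
    (Real.summable_one_div_nat_rpow.2 (by norm_num)).mul_left 5
  refine ⟨1 + ∑' c : ℕ, 5 * (1 / (c : ℝ) ^ (3 / 2 : ℝ)), ?_, fun N => ?_⟩
  · have : 0 ≤ ∑' c : ℕ, 5 * (1 / (c : ℝ) ^ (3 / 2 : ℝ)) := tsum_nonneg fun c => by positivity
    linarith
  · refine (Finset.sum_le_sum fun c hc => ?_).trans
      ((hs.sum_le_tsum (Finset.Ioc 0 N) fun c _ => by positivity).trans (by linarith))
    have hc1 : (1 : ℝ) ≤ c := by exact_mod_cast (Finset.mem_Ioc.1 hc).1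
    have hc0 : (0 : ℝ) < c := by linarith
    have h1 : Real.log c ≤ (c : ℝ) ^ (1 / 2 : ℝ) / (1 / 2) :=
      Real.log_le_rpow_div hc0.le (by norm_num)
    have h2 : 1 ≤ (c : ℝ) ^ (1 / 2 : ℝ) := Real.one_le_rpow hc1 (by norm_num)
    have h3 : (c : ℝ) ^ 2 = (c : ℝ) ^ (3 / 2 : ℝ) * (c : ℝ) ^ (1 / 2 : ℝ) := by
      rw [← Real.rpow_add hc0, ← Real.rpow_natCast]
      norm_num
    have h4 : 0 < (c : ℝ) ^ (3 / 2 : ℝ) := Real.rpow_pos_of_pos hc0 _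
    rw [h3, div_le_iff₀ (by positivity)]
    calc 1 + 2 * Real.log c ≤ 5 * (c : ℝ) ^ (1 / 2 : ℝ) := by linarith
      _ = _ := by field_simp

/-- Split log N = log t + 2 log c + log k with t = N/(c²k) ≥ 1. The bound log t ≤ t turns the
indicator into f(k)/k, Chebyshev handles log k, and ∑ (1 + 2 log c)/c² converges. -/
theorem exists_log_mul_sqMulCount_le :
    ∃ A : ℝ, 0 < A ∧ ∀ N : ℕ,
      Real.log N * sqMulCount N ≤ A * N * ∑ k ∈ Finset.Ioc 0 N, oneModFourInv k := by
  obtain ⟨A, hA, hsum⟩ := exists_sum_one_add_two_mul_log_div_sq_le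
  have hB : 0 < Real.log 4 + 4 := by positivity
  refine ⟨(1 + (Real.log 4 + 4)) * A, by positivity, fun N => ?_⟩
  set B := Real.log 4 + 4 with hBdef
  set S := ∑ k ∈ Finset.Ioc 0 N, oneModFourInv k with hS
  have hS0 : 0 ≤ S := sum_oneModFourInv_nonneg N
  have key : ∀ c ∈ Finset.Ioc 0 N,
      Real.log N * ∑ k ∈ Finset.Ioc 0 (N / c ^ 2), oneModFourIndicator k
        ≤ ((1 + B) * N * S) * ((1 + 2 * Real.log c) / (c : ℝ) ^ 2) := by
    intro c hc
    have hc1 : (1 : ℝ) ≤ c := by exact_mod_cast (Finset.mem_Ioc.1 hc).1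
    have hc0 : (0 : ℝ) < c := by linarith
    have hlc : 0 ≤ Real.log c := Real.log_nonneg hc1
    have hy : ((N / c ^ 2 : ℕ) : ℝ) ≤ N / (c : ℝ) ^ 2 := by
      have := Nat.cast_div_le (m := N) (n := c ^ 2) (α := ℝ)
      rwa [Nat.cast_pow] at this
    have hSy : ∑ k ∈ Finset.Ioc 0 (N / c ^ 2), oneModFourInv k ≤ S :=
      sum_oneModFourInv_mono (Nat.div_le_self _ _)
    have hSy0 := sum_oneModFourInv_nonneg (N / c ^ 2)
    have step : ∀ k ∈ Finset.Ioc 0 (N / c ^ 2), Real.log N * oneModFourIndicator k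
        ≤ N * ((1 + 2 * Real.log c) / (c : ℝ) ^ 2) * oneModFourInv k
          + oneModFourIndicator k * Real.log k := by
      intro k hk
      obtain ⟨hk0, hk1⟩ := Finset.mem_Ioc.1 hk
      have hk0' : (0 : ℝ) < k := by exact_mod_cast hk0
      have hle : (c : ℝ) ^ 2 * k ≤ N := by
        have := (Nat.le_div_iff_mul_le (pow_pos (Finset.mem_Ioc.1 hc).1 2)).1 hk1
        rw [mul_comm] at this
        exact_mod_cast this
      have hpos : (0 : ℝ) < (c : ℝ) ^ 2 * k := by positivity
      set t : ℝ := N / ((c : ℝ) ^ 2 * k) with ht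
      have ht1 : 1 ≤ t := (one_le_div hpos).2 hle
      have hN : (N : ℝ) = t * ((c : ℝ) ^ 2 * k) := by rw [ht]; field_simp
      have hlog : Real.log N = Real.log t + (2 * Real.log c + Real.log k) := by
        rw [hN, Real.log_mul (by positivity) hpos.ne', Real.log_mul (by positivity) hk0'.ne',
          Real.log_pow]
        norm_num
      have h1 : Real.log t ≤ t := (Real.log_le_sub_one_of_pos (by linarith)).trans (by linarith)
      have h2 : Real.log N ≤ t * (1 + 2 * Real.log c) + Real.log k := by
        rw [hlog]; nlinarith
      calc Real.log N * oneModFourIndicator k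
          ≤ (t * (1 + 2 * Real.log c) + Real.log k) * oneModFourIndicator k :=
            mul_le_mul_of_nonneg_right h2 (oneModFourIndicator_nonneg k)
        _ = _ := by rw [oneModFourInv_apply, ht]; field_simp
    calc Real.log N * ∑ k ∈ Finset.Ioc 0 (N / c ^ 2), oneModFourIndicator k
        ≤ N * ((1 + 2 * Real.log c) / (c : ℝ) ^ 2)
            * ∑ k ∈ Finset.Ioc 0 (N / c ^ 2), oneModFourInv k
          + ∑ k ∈ Finset.Ioc 0 (N / c ^ 2), oneModFourIndicator k * Real.log k := by
          rw [Finset.mul_sum, Finset.mul_sum, ← Finset.sum_add_distrib]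
          exact Finset.sum_le_sum step
      _ ≤ N * ((1 + 2 * Real.log c) / (c : ℝ) ^ 2) * S
          + B * (N / (c : ℝ) ^ 2) * S := by
          refine add_le_add (mul_le_mul_of_nonneg_left hSy (by positivity)) ?_
          refine (sum_oneModFourIndicator_mul_log_le _).trans ?_
          exact mul_le_mul (mul_le_mul_of_nonneg_left hy hB.le) hSy hSy0 (by positivity)
      _ ≤ N * ((1 + 2 * Real.log c) / (c : ℝ) ^ 2) * S
          + B * (N * ((1 + 2 * Real.log c) / (c : ℝ) ^ 2)) * S := by
          have : (N : ℝ) / (c : ℝ) ^ 2 ≤ N * ((1 + 2 * Real.log c) / (c : ℝ) ^ 2) := by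
            rw [← mul_div_assoc]
            exact div_le_div_of_nonneg_right (le_mul_of_one_le_right N.cast_nonneg (by linarith))
              (by positivity)
          gcongr
      _ = _ := by ring
  rw [sqMulCount, Finset.mul_sum]
  refine (Finset.sum_le_sum key).trans ?_
  rw [← Finset.mul_sum]
  calc _ ≤ ((1 + B) * N * S) * A := mul_le_mul_of_nonneg_left (hsum N) (by positivity)
    _ = _ := by ring

theorem exists_log_mul_sqMulCount_sq_le :
    ∃ A : ℝ, 0 < A ∧ ∀ N : ℕ, 2 ≤ N → Real.log N * sqMulCount N ^ 2 ≤ A * N ^ 2 := by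
  obtain ⟨A, hA, h⟩ := exists_log_mul_sqMulCount_le
  refine ⟨4 * A ^ 2, by positivity, fun N hN => ?_⟩
  have hl : 0 < Real.log N := Real.log_pos (by exact_mod_cast hN)
  -- This gives 1 + 2 log N ≤ 4 log N, the source of the factor 4.
  have hl2 : 1 / 2 ≤ Real.log N := by
    have h2 : Real.log 2 ≤ Real.log N := Real.log_le_log (by norm_num) (by exact_mod_cast hN)
    linarith [Real.log_two_gt_d9]
  have hT : 0 ≤ sqMulCount N :=
    Finset.sum_nonneg fun _ _ => Finset.sum_nonneg fun _ _ => oneModFourIndicator_nonneg _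
  have h1 : (Real.log N * sqMulCount N) ^ 2 ≤ (A * N) ^ 2 * (1 + 2 * Real.log N) := by
    calc (Real.log N * sqMulCount N) ^ 2
        ≤ (A * N * ∑ k ∈ Finset.Ioc 0 N, oneModFourInv k) ^ 2 :=
          pow_le_pow_left₀ (by positivity) (h N) 2
      _ = (A * N) ^ 2 * (∑ k ∈ Finset.Ioc 0 N, oneModFourInv k) ^ 2 := by ring
      _ ≤ _ := mul_le_mul_of_nonneg_left (sum_oneModFourInv_sq_le N) (by positivity)
  have h2 : (A * N) ^ 2 * (1 + 2 * Real.log N) ≤ (A * N) ^ 2 * (4 * Real.log N) :=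
    mul_le_mul_of_nonneg_left (by linarith) (by positivity)
  refine le_of_mul_le_mul_left ?_ hl
  nlinarith

open Classical in
/-- The integers `n ≤ N` that are sums of two squares. -/
noncomputable def sumTwoSquaresUpTo (N : ℕ) : Finset ℕ :=
  (Finset.range (N + 1)).filter fun n => ∃ x y : ℕ, n = x ^ 2 + y ^ 2

theorem card_sumTwoSquaresUpTo_le (N : ℕ) :
    ((sumTwoSquaresUpTo N).card : ℝ) ≤ 1 + 2 * sqMulCount N := by
  classical
  set U : Finset ((_ : ℕ) × ℕ) := (Finset.Ioc 0 N).sigma fun c =>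
    (Finset.Ioc 0 (N / c ^ 2)).filter DivisorsOneModFour with hU
  have hUcard : (U.card : ℝ) = sqMulCount N := by
    rw [hU, Finset.card_sigma, Nat.cast_sum, sqMulCount]
    refine Finset.sum_congr rfl fun c _ => ?_
    rw [Finset.card_filter]
    push_cast
    refine Finset.sum_congr rfl fun k _ => ?_
    split_ifs with h
    · rw [oneModFourIndicator_apply_of h]
    · rw [oneModFourIndicator_apply_of_not h]
  have hsub : sumTwoSquaresUpTo N ⊆
      {0} ∪ (U.image (fun p => p.1 ^ 2 * p.2) ∪ U.image fun p => 2 * (p.1 ^ 2 * p.2)) := by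
    intro n hn
    obtain ⟨hnN, hn2⟩ := Finset.mem_filter.1 hn
    rw [Finset.mem_range, Nat.lt_succ_iff] at hnN
    rcases eq_or_ne n 0 with rfl | hn0
    · simp
    obtain ⟨c, k, hk, h⟩ := exists_eq_mul_sq_mul_of_eq_sq_add_sq hn0 hn2
    have hk0 : 0 < k := Nat.pos_of_ne_zero hk.ne_zero
    have hc0 : 0 < c := by
      rcases Nat.eq_zero_or_pos c with rfl | h0
      · simp at h; omega
      · exact h0
    have hle : c ^ 2 * k ≤ N := by omega
    have hmem : (⟨c, k⟩ : (_ : ℕ) × ℕ) ∈ U := by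
      rw [hU, Finset.mem_sigma, Finset.mem_filter, Finset.mem_Ioc, Finset.mem_Ioc,
        Nat.le_div_iff_mul_le (pow_pos hc0 2)]
      exact ⟨⟨hc0, by nlinarith⟩, ⟨hk0, by rw [mul_comm]; exact hle⟩, hk⟩
    rw [Finset.mem_union, Finset.mem_union, Finset.mem_image, Finset.mem_image]
    rcases h with h | h
    · exact Or.inr (Or.inl ⟨_, hmem, h.symm⟩)
    · exact Or.inr (Or.inr ⟨_, hmem, h.symm⟩)
  have hcard : (sumTwoSquaresUpTo N).card ≤ 1 + (U.card + U.card) :=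
    (Finset.card_le_card hsub).trans ((Finset.card_union_le _ _).trans
      (Nat.add_le_add (by simp) ((Finset.card_union_le _ _).trans
        (Nat.add_le_add Finset.card_image_le Finset.card_image_le))))
  have : ((sumTwoSquaresUpTo N).card : ℝ) ≤ 1 + (U.card + U.card) := by exact_mod_cast hcard
  linarith

/-- The upper bound `O(N / √(log N))` for the number of sums of two squares up to `N`. -/
theorem exists_card_sumTwoSquaresUpTo_sq_mul_log_le :
    ∃ A : ℝ, 0 < A ∧ ∀ N : ℕ, 2 ≤ N →
      ((sumTwoSquaresUpTo N).card : ℝ) ^ 2 * Real.log N ≤ A * N ^ 2 := by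
  obtain ⟨A, hA, h⟩ := exists_log_mul_sqMulCount_sq_le
  -- From (1 + 2T)² ≤ 2 + 8T² and log N ≤ N².
  refine ⟨8 * A + 2, by positivity, fun N hN => ?_⟩
  have hN1 : (1 : ℝ) ≤ N := by exact_mod_cast (by omega : 1 ≤ N)
  have hl : 0 ≤ Real.log N := Real.log_nonneg hN1
  have hlN : Real.log N ≤ N ^ 2 :=
    (Real.log_le_sub_one_of_pos (by linarith)).trans (by nlinarith)
  have h1 : ((sumTwoSquaresUpTo N).card : ℝ) ^ 2 ≤ 2 + 8 * sqMulCount N ^ 2 :=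
    (pow_le_pow_left₀ (Nat.cast_nonneg _) (card_sumTwoSquaresUpTo_le N) 2).trans
      (by nlinarith [sq_nonneg (1 - 2 * sqMulCount N)])
  calc ((sumTwoSquaresUpTo N).card : ℝ) ^ 2 * Real.log N
      ≤ (2 + 8 * sqMulCount N ^ 2) * Real.log N := mul_le_mul_of_nonneg_right h1 hl
    _ = 2 * Real.log N + 8 * (Real.log N * sqMulCount N ^ 2) := by ring
    _ ≤ 2 * N ^ 2 + 8 * (A * N ^ 2) := by linarith [h N hN]
    _ = _ := by ring

/-! ### Splitting the double plane into two real planes -/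

namespace DoublePlane

/-- The point of the double plane with real part `x.1` and imaginary part `x.2`. -/
noncomputable def ofParts (x : (ℕ × ℕ) × ℕ × ℕ) : DoublePlane :=
  (⟨((x.1.1 : ℝ) + x.2.1) / 2, ((x.1.1 : ℝ) - x.2.1) / 2⟩,
    ⟨((x.1.2 : ℝ) + x.2.2) / 2, ((x.1.2 : ℝ) - x.2.2) / 2⟩)

theorem realPart_ofParts (x : (ℕ × ℕ) × ℕ × ℕ) :
    realPart (ofParts x) = ((x.1.1 : ℝ), (x.1.2 : ℝ)) := by
  simp only [realPart, ofParts, Prod.mk.injEq]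
  constructor <;> ring

theorem imagPart_ofParts (x : (ℕ × ℕ) × ℕ × ℕ) :
    imagPart (ofParts x) = ((x.2.1 : ℝ), (x.2.2 : ℝ)) := by
  simp only [imagPart, ofParts, Prod.mk.injEq]
  constructor <;> ring

theorem ofParts_injective : Function.Injective ofParts := by
  rintro ⟨⟨a, b⟩, c, d⟩ ⟨⟨a', b'⟩, c', d'⟩ h
  have h1 := congrArg realPart h
  have h2 := congrArg imagPart h
  rw [realPart_ofParts, realPart_ofParts] at h1
  rw [imagPart_ofParts, imagPart_ofParts] at h2
  simp only [Prod.mk.injEq, Nat.cast_inj] at h1 h2 ⊢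
  exact ⟨h1, h2⟩

theorem ext_parts {p q : DoublePlane} (hr : realPart p = realPart q)
    (hi : imagPart p = imagPart q) : p = q := by
  simp only [realPart, imagPart, Prod.mk.injEq] at hr hi
  refine Prod.ext (QuadraticAlgebra.ext ?_ ?_) (QuadraticAlgebra.ext ?_ ?_) <;> linarith

/-- The finite set of parameters of the points of `gridProduct m`. -/
def gridIndex (m : ℕ) : Finset ((ℕ × ℕ) × ℕ × ℕ) :=
  (Finset.Icc 1 m ×ˢ Finset.Icc 1 m) ×ˢ (Finset.Icc 1 m ×ˢ Finset.Icc 1 m)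

theorem card_gridIndex (m : ℕ) : (gridIndex m).card = m ^ 4 := by
  simp only [gridIndex, Finset.card_product, Nat.card_Icc]
  simp only [Nat.add_sub_cancel]
  ring

theorem gridProduct_eq_image (m : ℕ) :
    gridProduct m = ofParts '' (gridIndex m : Set ((ℕ × ℕ) × ℕ × ℕ)) := by
  ext p
  constructor
  · rintro ⟨⟨a, ha, b, hb, hr⟩, c, hc, d, hd, hi⟩
    refine ⟨((a, b), c, d), ?_, ext_parts ?_ ?_⟩
    · exact Finset.mem_coe.2 (Finset.mem_product.2
        ⟨Finset.mem_product.2 ⟨ha, hb⟩, Finset.mem_product.2 ⟨hc, hd⟩⟩)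
    · rw [realPart_ofParts, hr]
    · rw [imagPart_ofParts, hi]
  · rintro ⟨⟨⟨a, b⟩, c, d⟩, h, rfl⟩
    simp only [gridIndex, Finset.mem_coe, Finset.mem_product] at h
    exact ⟨⟨a, h.1.1, b, h.1.2, realPart_ofParts _⟩, c, h.2.1, d, h.2.2, imagPart_ofParts _⟩

theorem finite_gridProduct (m : ℕ) : (gridProduct m).Finite := by
  rw [gridProduct_eq_image]
  exact (Finset.finite_toSet _).image _

theorem ncard_gridProduct (m : ℕ) : (gridProduct m).ncard = m ^ 4 := by
  rw [gridProduct_eq_image, Set.ncard_image_of_injective _ ofParts_injective,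
    Set.ncard_coe_finset, card_gridIndex]

/-- The double number with real part `x.1` and imaginary part `x.2`. -/
noncomputable def numberOfParts (x : ℕ × ℕ) : DoubleNumber :=
  ⟨((x.1 : ℝ) + x.2) / 2, ((x.1 : ℝ) - x.2) / 2⟩

theorem re_add_im_rho (p q : DoublePlane) :
    (rho p q).re + (rho p q).im =
      ((realPart p).1 - (realPart q).1) ^ 2 + ((realPart p).2 - (realPart q).2) ^ 2 := by
  simp only [rho, realPart, sq, QuadraticAlgebra.re_add, QuadraticAlgebra.im_add,
    QuadraticAlgebra.re_mul, QuadraticAlgebra.im_mul, QuadraticAlgebra.re_sub,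
    QuadraticAlgebra.im_sub]
  ring

theorem re_sub_im_rho (p q : DoublePlane) :
    (rho p q).re - (rho p q).im =
      ((imagPart p).1 - (imagPart q).1) ^ 2 + ((imagPart p).2 - (imagPart q).2) ^ 2 := by
  simp only [rho, imagPart, sq, QuadraticAlgebra.re_add, QuadraticAlgebra.im_add,
    QuadraticAlgebra.re_mul, QuadraticAlgebra.im_mul, QuadraticAlgebra.re_sub,
    QuadraticAlgebra.im_sub]
  ring

theorem exists_dist_sq_of_mem_intGrid {m : ℕ} {u v : ℝ × ℝ} (hu : u ∈ intGrid m)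
    (hv : v ∈ intGrid m) :
    ∃ n ∈ sumTwoSquaresUpTo (2 * m ^ 2), (u.1 - v.1) ^ 2 + (u.2 - v.2) ^ 2 = n := by
  obtain ⟨a, ha, b, hb, rfl⟩ := hu
  obtain ⟨c, hc, d, hd, rfl⟩ := hv
  rw [Finset.mem_Icc] at ha hb hc hd
  refine ⟨((a : ℤ) - c).natAbs ^ 2 + ((b : ℤ) - d).natAbs ^ 2, ?_, ?_⟩
  · have h1 : ((a : ℤ) - c).natAbs ≤ m := by omega
    have h2 : ((b : ℤ) - d).natAbs ≤ m := by omega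
    have h3 := Nat.pow_le_pow_left h1 2
    have h4 := Nat.pow_le_pow_left h2 2
    exact Finset.mem_filter.2 ⟨Finset.mem_range.2 (by omega), _, _, rfl⟩
  · simp only [Nat.cast_add, Nat.cast_pow, Nat.cast_natAbs, Int.cast_abs, sq_abs]
    push_cast
    ring

theorem distanceSet_gridProduct_subset (m : ℕ) :
    distanceSet (gridProduct m) ⊆ numberOfParts ''
      ((sumTwoSquaresUpTo (2 * m ^ 2) ×ˢ sumTwoSquaresUpTo (2 * m ^ 2) : Finset (ℕ × ℕ)) :
        Set (ℕ × ℕ)) := by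
  rintro _ ⟨p, hp, q, hq, rfl⟩
  obtain ⟨s, hs, hs'⟩ := exists_dist_sq_of_mem_intGrid hp.1 hq.1
  obtain ⟨t, ht, ht'⟩ := exists_dist_sq_of_mem_intGrid hp.2 hq.2
  rw [← re_add_im_rho] at hs'
  rw [← re_sub_im_rho] at ht'
  refine ⟨(s, t), Finset.mem_coe.2 (Finset.mem_product.2 ⟨hs, ht⟩), ?_⟩
  refine QuadraticAlgebra.ext ?_ ?_ <;> simp only [numberOfParts] <;> linarith

/-- Stated for subsets so that it also serves n that are not fourth powers. -/
theorem numDistances_le_of_subset_gridProduct {P : Set DoublePlane} {m : ℕ}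
    (h : P ⊆ gridProduct m) :
    numDistances P ≤ (sumTwoSquaresUpTo (2 * m ^ 2)).card ^ 2 := by
  have hsub : distanceSet P ⊆ distanceSet (gridProduct m) := by
    rintro d ⟨p, hp, q, hq, rfl⟩
    exact ⟨p, h hp, q, h hq, rfl⟩
  refine (Set.ncard_le_ncard (hsub.trans (distanceSet_gridProduct_subset m))
    ((Finset.finite_toSet _).image _)).trans ((Set.ncard_image_le (Finset.finite_toSet _)).trans ?_)
  rw [Set.ncard_coe_finset, Finset.card_product, ← sq]

theorem exists_numDistances_le_of_subset_gridProduct :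
    ∃ C : ℝ, 0 < C ∧ ∀ m : ℕ, 2 ≤ m → ∀ P : Set DoublePlane, P ⊆ gridProduct m →
      (numDistances P : ℝ) ≤ C * ((m : ℝ) ^ 4 / Real.log ((m : ℝ) ^ 4)) := by
  obtain ⟨A, hA, h⟩ := exists_card_sumTwoSquaresUpTo_sq_mul_log_le
  -- Landau at N = 2m² gives 4A·m⁴; log N ≥ 2 log m halves this, and log m⁴ = 4 log m multiplies it
  -- by 4.
  refine ⟨8 * A, by positivity, fun m hm P hP => ?_⟩
  have hm1 : (1 : ℝ) < m := by exact_mod_cast hm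
  have hlm : 0 < Real.log m := Real.log_pos hm1
  have h1 : (numDistances P : ℝ) ≤ ((sumTwoSquaresUpTo (2 * m ^ 2)).card : ℝ) ^ 2 := by
    exact_mod_cast numDistances_le_of_subset_gridProduct hP
  have h2 := h (2 * m ^ 2) (by nlinarith)
  have h3 : 2 * Real.log m ≤ Real.log ((2 * m ^ 2 : ℕ) : ℝ) := by
    have : Real.log ((m : ℝ) ^ 2) = 2 * Real.log m := by rw [Real.log_pow]; norm_num
    rw [← this]
    refine Real.log_le_log (by positivity) ?_
    push_cast
    nlinarith
  have h4 : Real.log ((m : ℝ) ^ 4) = 4 * Real.log m := by rw [Real.log_pow]; norm_num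
  rw [h4, ← mul_div_assoc, le_div_iff₀ (by positivity)]
  push_cast at h2 h3
  have h5 := mul_le_mul_of_nonneg_left h3
    (sq_nonneg ((sumTwoSquaresUpTo (2 * m ^ 2)).card : ℝ))
  have h6 := mul_le_mul_of_nonneg_right h1 hlm.le
  nlinarith

end DoublePlane

/-! ### Arbitrary n and conclusion -/

/-- Every `n ≥ 2` lies below a fourth power that is at most `16 * n`. -/
theorem exists_le_pow_four_le {n : ℕ} (hn : 2 ≤ n) :
    ∃ m : ℕ, 2 ≤ m ∧ n ≤ m ^ 4 ∧ m ^ 4 ≤ 16 * n := by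
  classical
  have hex : ∃ m : ℕ, n ≤ m ^ 4 := ⟨n, Nat.le_self_pow (by norm_num) n⟩
  have hspec := Nat.find_spec hex
  have hm2 : 2 ≤ Nat.find hex := by
    by_contra hlt
    have h1 := Nat.pow_le_pow_left (by omega : Nat.find hex ≤ 1) 4
    omega
  refine ⟨Nat.find hex, hm2, hspec, ?_⟩
  have hpred : (Nat.find hex - 1) ^ 4 < n :=
    not_le.1 (Nat.find_min hex (by omega))
  -- For the least m, m ≥ 2 gives m ≤ 2(m − 1), so m⁴ ≤ 16(m − 1)⁴ < 16n.
  have hle := Nat.pow_le_pow_left (by omega : Nat.find hex ≤ 2 * (Nat.find hex - 1)) 4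
  rw [mul_pow] at hle
  omega

theorem mainTheorem5 :
    ∃ C : ℝ, 0 < C ∧
      (∀ m : ℕ, 2 ≤ m →
        (DoublePlane.gridProduct m).Finite ∧
        (DoublePlane.gridProduct m).ncard = m ^ 4 ∧
        (DoublePlane.numDistances (DoublePlane.gridProduct m) : ℝ)
          ≤ C * ((m : ℝ) ^ 4 / Real.log ((m : ℝ) ^ 4))) ∧
      (∀ n : ℕ, 2 ≤ n →
        ∃ P : Set DoublePlane, P.Finite ∧ P.ncard = n ∧
          (DoublePlane.numDistances P : ℝ) ≤ C * ((n : ℝ) / Real.log (n : ℝ))) := by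
  obtain ⟨C, hC, h⟩ := DoublePlane.exists_numDistances_le_of_subset_gridProduct
  refine ⟨16 * C, by positivity, fun m hm => ⟨DoublePlane.finite_gridProduct m,
    DoublePlane.ncard_gridProduct m, ?_⟩, fun n hn => ?_⟩
  · have hm1 : (1 : ℝ) ≤ (m : ℝ) ^ 4 := one_le_pow₀ (by exact_mod_cast (by omega : 1 ≤ m))
    have h0 : 0 ≤ (m : ℝ) ^ 4 / Real.log ((m : ℝ) ^ 4) :=
      div_nonneg (by positivity) (Real.log_nonneg hm1)
    exact (h m hm _ subset_rfl).trans (mul_le_mul_of_nonneg_right (by linarith) h0)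
  · obtain ⟨m, hm, hnm, hmn⟩ := exists_le_pow_four_le hn
    obtain ⟨P, hP, hPn⟩ := Set.exists_subset_card_eq
      (s := DoublePlane.gridProduct m) (n := n) (by rwa [DoublePlane.ncard_gridProduct])
    refine ⟨P, (DoublePlane.finite_gridProduct m).subset hP, hPn, (h m hm P hP).trans ?_⟩
    have hn1 : (1 : ℝ) < n := by exact_mod_cast hn
    have hnm' : (n : ℝ) ≤ (m : ℝ) ^ 4 := by exact_mod_cast hnm
    have hmn' : (m : ℝ) ^ 4 ≤ 16 * n := by exact_mod_cast hmn
    calc C * ((m : ℝ) ^ 4 / Real.log ((m : ℝ) ^ 4))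
        ≤ C * (16 * n / Real.log n) :=
          mul_le_mul_of_nonneg_left (div_le_div₀ (by positivity) hmn' (Real.log_pos hn1)
            (Real.log_le_log (by linarith) hnm')) hC.le
      _ = _ := by ring
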